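/- Let $a,b,c,d$ be natural numbers with $a\le d$, $b\le d$, $c\le d$ and $(a+b-c+1)(d-c)=3$. Let $\mathbb{C}[s,t]_d$ be the space of complex binary forms of degree $d$; let $\sigma\in\mathrm{PGL}(2,\mathbb{C})$ act on its subspaces by linear change of the coordinates $s,t$, written $V\mapsto V^\sigma$; and let $\mathrm{Gr}(a,d)$ and $\mathrm{Gr}(b,d)$ be the Grassmannians of vector subspaces of $\mathbb{C}[s,t]_d$ of dimension $a+1$ and $b+1$, respectively. (1) For general $V_a,V_b$ there are only finitely many $\sigma$ with $\dim(V_a+V_b^\sigma)\le c+1$. That is, there is a nonempty (hence dense) Zariski-open subset $U\subseteq \mathrm{Gr}(a,d)\times\mathrm{Gr}(b,d)$ such that for every $(V_a,V_b)\in U$ the set $$\{\sigma\in\mathrm{PGL}(2,\mathbb{C}) : \dim(V_a+V_b^{\sigma})\le c+1\}$$ is finite. (2) If moreover $a\le c$ and $b\le c$, then the incidence variety $$\mathscr{I}=\{(\sigma,V_a,V_b)\in \mathrm{PGL}(2,\mathbb{C})\times\mathrm{Gr}(a,d)\times\mathrm{Gr}(b,d) : \dim(V_a+V_b^{\sigma})\le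 c+1\}$$ dominates $\mathrm{Gr}(a,d)\times\mathrm{Gr}(b,d)$: the image of the projection $\mathscr{I}\to\mathrm{Gr}(a,d)\times\mathrm{Gr}(b,d)$ is Zariski dense. -/

import Mathlib

open scoped MatrixGroups

noncomputable section

namespace BinaryForms

/-- `ℂ[s,t]_d`: the complex vector space of binary forms of degree `d`
(with `s = X 0` and `t = X 1`). -/
def Forms (d : ℕ) : Type :=
  MvPolynomial.homogeneousSubmodule (Fin 2) ℂ d

instance (d : ℕ) : AddCommGroup (Forms d) :=
  inferInstanceAs (AddCommGroup (MvPolynomial.homogeneousSubmodule (Fin 2) ℂ d))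

instance (d : ℕ) : Module ℂ (Forms d) :=
  inferInstanceAs (Module ℂ (MvPolynomial.homogeneousSubmodule (Fin 2) ℂ d))

/-- A binary form, as a polynomial. -/
def Forms.toPoly (d : ℕ) : Forms d →ₗ[ℂ] MvPolynomial (Fin 2) ℂ :=
  (MvPolynomial.homogeneousSubmodule (Fin 2) ℂ d).subtype

/-- The linear change of coordinates `F ↦ F (g₀₀ s + g₀₁ t, g₁₀ s + g₁₁ t)` on binary forms. -/
def substForms (d : ℕ) (g : GL (Fin 2) ℂ) : Forms d →ₗ[ℂ] Forms d :=
  (MvPolynomial.aeval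
    (fun i : Fin 2 => ∑ j : Fin 2, MvPolynomial.C (g.val i j) *
      (MvPolynomial.X j : MvPolynomial (Fin 2) ℂ))).toLinearMap.restrict (by
    intro F hF
    have hX : ∀ i : Fin 2, (∑ j : Fin 2, MvPolynomial.C (g.val i j) *
        (MvPolynomial.X j : MvPolynomial (Fin 2) ℂ)).IsHomogeneous 1 := fun i =>
      MvPolynomial.IsHomogeneous.sum _ _ _ fun j _ => MvPolynomial.isHomogeneous_C_mul_X _ j
    have h := MvPolynomial.IsHomogeneous.aeval (R := ℂ) (n := 1) hF _ hX
    simpa using h)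

/-- Multiplying the change of coordinates by a nonzero scalar `u` multiplies a form of degree `d`
by `u ^ d`. -/
theorem substForms_mul_scalar (d : ℕ) (g : GL (Fin 2) ℂ) (u : ℂˣ) :
    substForms d (g * Matrix.GeneralLinearGroup.scalar (Fin 2) u) =
      (u.val ^ d) • substForms d g := by
  have hL : (fun i : Fin 2 => ∑ j : Fin 2,
        MvPolynomial.C ((g * Matrix.GeneralLinearGroup.scalar (Fin 2) u).val i j) *
          (MvPolynomial.X j : MvPolynomial (Fin 2) ℂ)) =
      fun i => MvPolynomial.C u.val * ∑ j : Fin 2, MvPolynomial.C (g.val i j) *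
        (MvPolynomial.X j : MvPolynomial (Fin 2) ℂ) := by
    funext i
    rw [Finset.mul_sum]
    refine Finset.sum_congr rfl fun j _ => ?_
    rw [← mul_assoc, ← map_mul]
    congr 2
    simp [Matrix.GeneralLinearGroup.scalar, mul_comm]
  refine LinearMap.ext fun F => Subtype.ext ?_
  change MvPolynomial.aeval _ F.1 = u.val ^ d • MvPolynomial.aeval _ F.1
  rw [hL, MvPolynomial.aeval_def, MvPolynomial.aeval_def, MvPolynomial.eval₂_eq,
    MvPolynomial.eval₂_eq, Finset.smul_sum]
  refine Finset.sum_congr rfl fun m hm => ?_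
  have hd : ∑ i ∈ m.support, m i = d := by
    have h1 := (MvPolynomial.mem_homogeneousSubmodule d F.1).1 F.2 (MvPolynomial.mem_support_iff.1 hm)
    rw [Finsupp.weight_apply, Finsupp.sum] at h1
    simpa using h1
  simp only [mul_pow, Finset.prod_mul_distrib, Finset.prod_pow_eq_pow_sum, hd]
  rw [← map_pow, MvPolynomial.smul_eq_C_mul]
  ring

/-- The translate `V^σ` of a space of binary forms under `σ ∈ PGL(2, ℂ)`: the image of `V` under
the change of coordinates given by any matrix representing `σ`. -/
def translate {d : ℕ} (V : Submodule ℂ (Forms d)) (σ : PGL(2, ℂ)) : Submodule ℂ (Forms d) :=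
  Quotient.liftOn' (s₁ := QuotientGroup.leftRel (Subgroup.center (GL (Fin 2) ℂ))) σ
    (fun g => V.map (substForms d g)) (by
      intro g h hgh
      obtain ⟨u, rfl⟩ := Matrix.ProjGenLinGroup.mk_eq_mk_iff.1
        (show Matrix.ProjGenLinGroup.mk g = Matrix.ProjGenLinGroup.mk h from Quotient.sound' hgh)
      simp only [substForms_mul_scalar]
      exact (Submodule.map_smul _ _ _ (pow_ne_zero _ u.ne_zero)).symm)

theorem translate_mk {d : ℕ} (V : Submodule ℂ (Forms d)) (g : GL (Fin 2) ℂ) :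
    translate V (Matrix.ProjGenLinGroup.mk g) = V.map (substForms d g) := rfl

/-- The Grassmannian of `(a+1)`-dimensional vector subspaces of `ℂ[s,t]_d`, that is, of
`a`-dimensional linear subvarieties of the projective space of binary forms of degree `d`. -/
abbrev Gr (a d : ℕ) : Type :=
  {V : Submodule ℂ (Forms d) // Module.finrank ℂ V = a + 1}

/-- The Zariski topology on the affine space `ℂ^ι`: the sets `{x | p x ≠ 0}`, for polynomials `p`,
form a basis. -/
abbrev zariskiAffine (ι : Type) : TopologicalSpace (ι → ℂ) :=
  TopologicalSpace.generateFrom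
    {O | ∃ p : MvPolynomial ι ℂ, O = {x | MvPolynomial.eval x p ≠ 0}}

/-- The ordered bases of `(a+1)`-dimensional subspaces of `ℂ[s,t]_d`. -/
abbrev Frame (a d : ℕ) : Type :=
  {F : Fin (a + 1) → Forms d // LinearIndependent ℂ F}

/-- The coefficient of `s^(d-k) t^k` in the `i`-th form of a frame. -/
def Frame.coord {a d : ℕ} (F : Frame a d) (ik : Fin (a + 1) × Fin (d + 1)) : ℂ :=
  MvPolynomial.coeff (Finsupp.single 0 (d - (ik.2 : ℕ)) + Finsupp.single 1 (ik.2 : ℕ))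
    (Forms.toPoly d (F.1 ik.1))

/-- The subspace spanned by a frame. -/
def Frame.span {a d : ℕ} (F : Frame a d) : Gr a d :=
  ⟨Submodule.span ℂ (Set.range F.1), by simpa using finrank_span_eq_card F.2⟩

/-- The Zariski topology on pairs of frames, as an open subset of the affine space of pairs of
coefficient matrices. -/
abbrev zariskiFrames (a b d : ℕ) : TopologicalSpace (Frame a d × Frame b d) :=
  TopologicalSpace.induced (fun F => Sum.elim F.1.coord F.2.coord)
    (zariskiAffine ((Fin (a + 1) × Fin (d + 1)) ⊕ (Fin (b + 1) × Fin (d + 1))))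

/-- The Zariski topology on the variety `Gr(a,d) × Gr(b,d)`. The map sending a pair of frames to
the pair of their spans is a Zariski locally trivial principal bundle with structure group
`GL(a+1) × GL(b+1)`, so the Zariski topology of the base is the quotient topology. (It is finer than
the product of the Zariski topologies of the factors.) -/
abbrev zariskiGr (a b d : ℕ) : TopologicalSpace (Gr a d × Gr b d) :=
  TopologicalSpace.coinduced (fun F : Frame a d × Frame b d => (F.1.span, F.2.span))
    (zariskiFrames a b d)

/-- The incidence variety of all `(σ, V_a, V_b)` with `dim (V_a + V_b^σ) ≤ c + 1`. -/
def incidence (a b c d : ℕ) : Set (PGL(2, ℂ) × (Gr a d × Gr b d)) :=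
  {x | Module.finrank ℂ ↥(x.2.1.1 ⊔ translate x.2.2.1 x.1) ≤ c + 1}

end BinaryForms

end

open scoped MatrixGroups

noncomputable section

namespace BinaryForms

/-! Put r = a + b - c + 1. If V_a and V_b^σ together span a space W of dimension c + 1, then r is
the dimension of their intersection, and the hypothesis says r(d - c) = 3 = dim PGL(2).

Finiteness is a parameter count. The data of σ, W and frames inside W are covered by finitely many
affine charts, each with exactly as many parameters as a pair of frames has coefficients
(`card_param`). Hence every entry of a normalized matrix of σ⁻¹ satisfies a nonzero polynomial
relation over the ring of polynomials in the frame coefficients (`exists_algebraic_relation`). Where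
the leading coefficients do not vanish, each entry takes finitely many values
(`exists_finite_locus`). Dominance plays no role here: a relation of degree 0 in the entry simply
excludes every σ in that chart.

For density, one incident pair with surjective differential suffices: incident pairs of frames then
fill a Euclidean open set, on which no nonzero polynomial vanishes identically
(`dense_of_surjective`). Take σ = 1 and let V_a, V_b be spanned by parts of a basis of W sharing its
first r elements. Moving W, and V_b inside W, accounts for everything except Hom(V_a ∩ V_b, ℂ[s,t]_d
/ W), of dimension r(d - c) = 3; the 2 × 2 matrices modulo scalars must map onto it
(`dense_of_tangent`). Since 3 is prime, (r, d - c) is (1, 3) or (3, 1), and an explicit W settles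
each case. -/

/-! ### Coefficients of binary forms and the matrix of a substitution. -/

/-- The exponent of the monomial `s^(d-k) t^k`. -/
def exponent (d k : ℕ) : Fin 2 →₀ ℕ := Finsupp.single 0 (d - k) + Finsupp.single 1 k

@[simp] theorem exponent_zero (d k : ℕ) : exponent d k 0 = d - k := by simp [exponent]

@[simp] theorem exponent_one (d k : ℕ) : exponent d k 1 = k := by simp [exponent]

theorem exponent_eq {d : ℕ} {m : Fin 2 →₀ ℕ} (hm : m 0 + m 1 = d) : m = exponent d (m 1) := by
  ext i
  fin_cases i
  · simp only [Fin.zero_eta, exponent_zero]; omega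
  · simp

theorem toPoly_isHomogeneous {d : ℕ} (F : Forms d) : (Forms.toPoly d F).IsHomogeneous d :=
  (MvPolynomial.mem_homogeneousSubmodule _ _).1 F.2

theorem toPoly_injective (d : ℕ) : Function.Injective (Forms.toPoly d) := Subtype.val_injective

/-- The coefficients of a binary form. -/
def coordsHom (d : ℕ) : Forms d →ₗ[ℂ] (Fin (d + 1) → ℂ) :=
  LinearMap.pi fun k => (MvPolynomial.lcoeff ℂ (exponent d k)).comp (Forms.toPoly d)

theorem coordsHom_apply {d : ℕ} (F : Forms d) (k : Fin (d + 1)) :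
    coordsHom d F k = MvPolynomial.coeff (exponent d k) (Forms.toPoly d F) := rfl

theorem coordsHom_injective (d : ℕ) : Function.Injective (coordsHom d) := by
  rw [← LinearMap.ker_eq_bot, LinearMap.ker_eq_bot']
  intro F hF
  apply toPoly_injective
  rw [map_zero]
  ext m
  rw [MvPolynomial.coeff_zero]
  by_contra hm
  have h1 := toPoly_isHomogeneous F hm
  have h2 : m 0 + m 1 = d := by
    rw [← h1, Finsupp.weight_apply, Finsupp.sum_fintype _ _ (by simp)]
    simp
  apply hm
  have := congrFun hF ⟨m 1, by omega⟩
  rw [coordsHom_apply] at this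
  rw [exponent_eq h2]
  simpa using this

/-- The monomial `s^(d-k) t^k`. -/
def monomialForm {d : ℕ} (k : Fin (d + 1)) : Forms d :=
  ⟨MvPolynomial.monomial (exponent d k) 1, by
    rw [MvPolynomial.mem_homogeneousSubmodule]
    apply MvPolynomial.isHomogeneous_monomial
    rw [Finsupp.degree_eq_sum]
    simp only [Fin.sum_univ_two, exponent_zero, exponent_one]
    omega⟩

theorem toPoly_monomialForm {d : ℕ} (k : Fin (d + 1)) :
    Forms.toPoly d (monomialForm k) = MvPolynomial.monomial (exponent d k) 1 := rfl

theorem coordsHom_sum {d : ℕ} (v : Fin (d + 1) → ℂ) :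
    coordsHom d (∑ k, v k • monomialForm k) = v := by
  funext m
  simp only [coordsHom_apply, map_sum, map_smul, toPoly_monomialForm, MvPolynomial.coeff_sum,
    MvPolynomial.coeff_smul, MvPolynomial.coeff_monomial, smul_eq_mul]
  rw [Finset.sum_eq_single m]
  · simp
  · intro k _ hk
    rw [if_neg, mul_zero]
    intro h
    apply hk
    ext
    simpa using DFunLike.congr_fun h 1
  · simp

/-- Binary forms of degree `d` are determined by their `d + 1` coefficients. -/
def coords (d : ℕ) : Forms d ≃ₗ[ℂ] (Fin (d + 1) → ℂ) :=
  LinearEquiv.ofBijective (coordsHom d) ⟨coordsHom_injective d, fun v => ⟨_, coordsHom_sum v⟩⟩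

theorem coord_eq {a d : ℕ} (F : Frame a d) (ik : Fin (a + 1) × Fin (d + 1)) :
    F.coord ik = coords d (F.1 ik.1) ik.2 := rfl

theorem eq_sum_monomialForm {d : ℕ} (F : Forms d) : F = ∑ k, coords d F k • monomialForm k :=
  coordsHom_injective d (coordsHom_sum (coords d F)).symm

instance (d : ℕ) : Module.Finite ℂ (Forms d) := Module.Finite.equiv (coords d).symm

/-- The matrix of the change of coordinates `h` on forms of degree `d`: the `k`-th row
consists of the coefficients of `(h₀₀ s + h₀₁ t)^(d-k) (h₁₀ s + h₁₁ t)^k`. -/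
def rho {R : Type*} [CommRing R] (d : ℕ) (h : Matrix (Fin 2) (Fin 2) R) :
    Matrix (Fin (d + 1)) (Fin (d + 1)) R :=
  Matrix.of fun k m => ((Polynomial.C (h 0 0) + Polynomial.C (h 0 1) * Polynomial.X) ^ (d - (k : ℕ)) *
    (Polynomial.C (h 1 0) + Polynomial.C (h 1 1) * Polynomial.X) ^ (k : ℕ)).coeff m

theorem rho_apply {R : Type*} [CommRing R] (d : ℕ) (h : Matrix (Fin 2) (Fin 2) R)
    (k m : Fin (d + 1)) : rho d h k m =
    ((Polynomial.C (h 0 0) + Polynomial.C (h 0 1) * Polynomial.X) ^ (d - (k : ℕ)) *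
    (Polynomial.C (h 1 0) + Polynomial.C (h 1 1) * Polynomial.X) ^ (k : ℕ)).coeff m := rfl

theorem rho_map {R S : Type*} [CommRing R] [CommRing S] (f : R →+* S) (d : ℕ)
    (h : Matrix (Fin 2) (Fin 2) R) : rho d (h.map f) = (rho d h).map f := by
  ext k m
  simp only [rho_apply, Matrix.map_apply]
  rw [← Polynomial.coeff_map]
  simp

theorem aeval_toPoly {d : ℕ} {A : Type*} [CommRing A] [Algebra ℂ A] (x : Fin 2 → A) (F : Forms d) :
    MvPolynomial.aeval x (Forms.toPoly d F) =
      ∑ k : Fin (d + 1), algebraMap ℂ A (coords d F k) * (x 0 ^ (d - (k : ℕ)) * x 1 ^ (k : ℕ)) := by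
  conv_lhs => rw [eq_sum_monomialForm F]
  simp only [map_sum, map_smul, toPoly_monomialForm, MvPolynomial.aeval_monomial, map_one, one_mul]
  refine Finset.sum_congr rfl fun k _ => ?_
  rw [Algebra.smul_def, Finsupp.prod_fintype _ _ (by simp)]
  simp

theorem coords_eq_coeff {d : ℕ} (F : Forms d) (k : Fin (d + 1)) : coords d F k =
    (MvPolynomial.aeval ![1, (Polynomial.X : Polynomial ℂ)] (Forms.toPoly d F)).coeff k := by
  rw [aeval_toPoly]
  simp [Polynomial.coeff_X_pow, Fin.val_inj]

theorem toPoly_substForms (d : ℕ) (g : GL (Fin 2) ℂ) (F : Forms d) :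
    Forms.toPoly d (substForms d g F) = MvPolynomial.aeval
      (fun i : Fin 2 => ∑ j : Fin 2, MvPolynomial.C (g.val i j) *
        (MvPolynomial.X j : MvPolynomial (Fin 2) ℂ)) (Forms.toPoly d F) := rfl

theorem coords_substForms {d : ℕ} (h : GL (Fin 2) ℂ) (F : Forms d) :
    coords d (substForms d h F) = Matrix.vecMul (coords d F) (rho d h.val) := by
  funext m
  rw [coords_eq_coeff, toPoly_substForms, ← AlgHom.comp_apply, MvPolynomial.comp_aeval,
    aeval_toPoly]
  simp [Matrix.vecMul, dotProduct, rho_apply, Fin.sum_univ_two, ← MvPolynomial.algebraMap_eq]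

theorem substForms_substForms {d : ℕ} (g h : GL (Fin 2) ℂ) (F : Forms d) :
    substForms d g (substForms d h F) = substForms d (h * g) F := by
  apply toPoly_injective
  rw [toPoly_substForms, toPoly_substForms, toPoly_substForms, ← AlgHom.comp_apply,
    MvPolynomial.comp_aeval]
  congr 2
  funext i
  simp only [map_mul, ← MvPolynomial.algebraMap_eq, AlgHom.commutes,
    MvPolynomial.aeval_X, Units.val_mul, Matrix.mul_apply, Fin.sum_univ_two, map_add]
  ring

theorem substForms_one {d : ℕ} (F : Forms d) : substForms d 1 F = F := by
  apply toPoly_injective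
  rw [toPoly_substForms]
  have : (fun i : Fin 2 => ∑ j : Fin 2, MvPolynomial.C ((1 : GL (Fin 2) ℂ).val i j) *
        (MvPolynomial.X j : MvPolynomial (Fin 2) ℂ)) = MvPolynomial.X := by
    funext i
    fin_cases i <;> simp
  rw [this, MvPolynomial.aeval_X_left_apply]

theorem substForms_inv_substForms {d : ℕ} (h : GL (Fin 2) ℂ) (F : Forms d) :
    substForms d h⁻¹ (substForms d h F) = F := by
  rw [substForms_substForms, mul_inv_cancel, substForms_one]

theorem substForms_substForms_inv {d : ℕ} (h : GL (Fin 2) ℂ) (F : Forms d) :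
    substForms d h (substForms d h⁻¹ F) = F := by
  rw [substForms_substForms, inv_mul_cancel, substForms_one]

/-! ### Charts for incident pairs, and finiteness by counting parameters. -/

/-- Indices of the coefficients of a pair of frames. -/
abbrev Coef (a b d : ℕ) : Type := (Fin (a + 1) × Fin (d + 1)) ⊕ (Fin (b + 1) × Fin (d + 1))

/-- The coefficients of a pair of frames. -/
def pairCoeffs {a b d : ℕ} (F : Frame a d × Frame b d) : Coef a b d → ℂ :=
  Sum.elim F.1.coord F.2.coord

/-- The coefficients of the pair consisting of the frame `A w` and of the frame `B w` transformed
by `h`; both `A w` and `B w` lie in the row space of `w`. -/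
def incidentCoeffs {R : Type*} [CommRing R] {a b c d : ℕ} (h : Matrix (Fin 2) (Fin 2) R)
    (w : Matrix (Fin (c + 1)) (Fin (d + 1)) R) (A : Matrix (Fin (a + 1)) (Fin (c + 1)) R)
    (B : Matrix (Fin (b + 1)) (Fin (c + 1)) R) : Coef a b d → R :=
  Sum.elim (fun p => (A * w) p.1 p.2) (fun p => (B * w * rho d h) p.1 p.2)

/-- Allows evaluation at indeterminates, giving a tuple of polynomials, followed by specialization
to complex points. -/
theorem incidentCoeffs_map {R S : Type*} [CommRing R] [CommRing S] (f : R →+* S) {a b c d : ℕ}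
    (h : Matrix (Fin 2) (Fin 2) R)
    (w : Matrix (Fin (c + 1)) (Fin (d + 1)) R) (A : Matrix (Fin (a + 1)) (Fin (c + 1)) R)
    (B : Matrix (Fin (b + 1)) (Fin (c + 1)) R) (i : Coef a b d) :
    incidentCoeffs (h.map f) (w.map f) (A.map f) (B.map f) i = f (incidentCoeffs h w A B i) := by
  rcases i with p | p
  · simp only [incidentCoeffs, Sum.elim_inl, ← Matrix.map_mul, Matrix.map_apply]
  · simp only [incidentCoeffs, Sum.elim_inr, rho_map, ← Matrix.map_mul, Matrix.map_apply]

/-- On a subspace of dimension at most `c + 1`, some `c + 1` coordinates determine the others. -/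
theorem exists_chart {c d : ℕ} (hc : c ≤ d) (W : Submodule ℂ (Fin (d + 1) → ℂ))
    (hW : Module.finrank ℂ W ≤ c + 1) :
    ∃ (e : Fin (c + 1) ⊕ Fin (d - c) ≃ Fin (d + 1)) (M : Fin (c + 1) × Fin (d - c) → ℂ),
      ∀ x ∈ W, ∀ l, x (e (Sum.inr l)) = ∑ k, x (e (Sum.inl k)) * M (k, l) := by
  classical
  let φ : Fin (d + 1) → Module.Dual ℂ W := fun m => (LinearMap.proj m).comp W.subtype
  -- A maximal independent family of the coordinate functionals on `W` gives the pivots.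
  obtain ⟨κ, f, hf, hspan, hind⟩ := exists_linearIndependent' ℂ φ
  have : Finite κ := Finite.of_injective f hf
  have := Fintype.ofFinite κ
  have hκ : Fintype.card κ ≤ c + 1 := by
    have := hind.fintype_card_le_finrank
    rw [Subspace.dual_finrank_eq] at this
    omega
  -- `W` may have dimension below c + 1, so the pivots are padded to exactly c + 1 positions.
  obtain ⟨T, hT, hTc⟩ := Finset.exists_superset_card_eq (s := Finset.univ.image f) (n := c + 1)
    (by simpa [Finset.card_image_of_injective _ hf] using hκ) (by simpa using hc)
  let e := finSumEquivOfFinset hTc (n := d - c) (by rw [Finset.card_compl, hTc]; simp)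
  have key : ∀ l, ∃ M : Fin (c + 1) → ℂ, ∑ k, M k • φ (e (Sum.inl k)) = φ (e (Sum.inr l)) := by
    intro l
    rw [← Submodule.mem_span_range_iff_exists_fun]
    have h1 : φ (e (Sum.inr l)) ∈ Submodule.span ℂ (Set.range (φ ∘ f)) := by
      rw [hspan]
      exact Submodule.subset_span ⟨_, rfl⟩
    refine Submodule.span_mono ?_ h1
    rintro _ ⟨i, rfl⟩
    obtain ⟨y, hy⟩ := e.surjective (f i)
    rcases y with k | k
    · exact ⟨k, by simp [hy]⟩
    · exfalso
      have h2 : f i ∈ T := hT (by simp)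
      have h3 : e (Sum.inr k) ∈ Tᶜ := by
        simp only [e, finSumEquivOfFinset_inr]
        exact Finset.orderEmbOfFin_mem _ _ _
      rw [hy, Finset.mem_compl] at h3
      exact h3 h2
  choose M hM using key
  refine ⟨e, fun p => M p.2 p.1, fun x hx l => ?_⟩
  have := congrArg (fun ψ : Module.Dual ℂ W => ψ ⟨x, hx⟩) (hM l)
  simp only [LinearMap.sum_apply, LinearMap.smul_apply, φ, LinearMap.comp_apply,
    Submodule.subtype_apply, LinearMap.proj_apply, smul_eq_mul] at this
  rw [← this]
  exact Finset.sum_congr rfl fun k _ => mul_comm _ _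

/-- `ι` polynomials in fewer than `card ι + 1` variables satisfy, together with any further
polynomial `z`, an algebraic relation. -/
theorem exists_algebraic_relation {ι κ : Type} [Fintype ι] [Fintype κ]
    (hcard : Fintype.card κ ≤ Fintype.card ι) (y : ι → MvPolynomial κ ℂ) (z : MvPolynomial κ ℂ) :
    ∃ q : Polynomial (MvPolynomial ι ℂ), q ≠ 0 ∧ ∀ x : κ → ℂ,
      (q.map (MvPolynomial.eval fun i => MvPolynomial.eval x (y i))).eval
        (MvPolynomial.eval x z) = 0 := by
  -- The family has card ι + 1 members, more than the transcendence degree card κ of the polynomial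
  -- ring.
  have hdep : ¬ AlgebraicIndependent ℂ (fun o : Option ι => o.elim z y) := by
    intro hind
    have := hind.cardinalMk_le_trdeg
    rw [MvPolynomial.trdeg_of_isDomain] at this
    simp only [Cardinal.mk_fintype, Fintype.card_option, Cardinal.lift_natCast, Nat.cast_le] at this
    omega
  rw [algebraicIndependent_iff] at hdep
  push Not at hdep
  obtain ⟨f, hf, hf0⟩ := hdep
  refine ⟨MvPolynomial.optionEquivLeft ℂ ι f, by simpa using hf0, fun x => ?_⟩
  have h1 : ∀ p : MvPolynomial (Option ι) ℂ,
      ((MvPolynomial.optionEquivLeft ℂ ι p).map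
        (MvPolynomial.eval fun i => MvPolynomial.eval x (y i))).eval (MvPolynomial.eval x z) =
      MvPolynomial.eval x (MvPolynomial.aeval (fun o : Option ι => o.elim z y) p) := by
    intro p
    induction p using MvPolynomial.induction_on with
    | C r => simp [MvPolynomial.optionEquivLeft_C]
    | add p q hp hq => simp only [map_add, Polynomial.map_add, Polynomial.eval_add, hp, hq]
    | mul_X p o hp =>
      rw [map_mul, Polynomial.map_mul, Polynomial.eval_mul, hp, map_mul, map_mul]
      congr 1
      rcases o with _ | i <;> simp [MvPolynomial.optionEquivLeft_X_none, MvPolynomial.optionEquivLeft_X_some]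
  rw [h1, hf, map_zero]

/-- The entries of a `2 × 2` matrix other than the entry `(0, ε)`. -/
abbrev EntryIndex (ε : Fin 2) : Type := {p : Fin 2 × Fin 2 // p ≠ (0, ε)}

/-- Parameters for a matrix whose entry `(0, ε)` is `1`, a chart of the Grassmannian of
`(c + 1)`-dimensional subspaces, and pairs of frames in such a subspace. -/
abbrev Param (a b c d : ℕ) (ε : Fin 2) : Type :=
  EntryIndex ε ⊕ (Fin (c + 1) × Fin (d - c)) ⊕ (Fin (a + 1) × Fin (c + 1)) ⊕
    (Fin (b + 1) × Fin (c + 1))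

/-- The difference of the two sides, leaving out the 3 matrix entries, is (d - c)(a + b - c + 1);
this is the only use of the numerical hypothesis in the finiteness proof. -/
theorem card_param {a b c d : ℕ} (ε : Fin 2) (hc : c ≤ d)
    (h : ((a : ℤ) + b - c + 1) * ((d : ℤ) - c) = 3) :
    Fintype.card (Param a b c d ε) = Fintype.card (Coef a b d) := by
  have h3 : Fintype.card (EntryIndex ε) = 3 := by
    rw [Fintype.card_subtype_compl]
    simp
  simp only [Fintype.card_sum, Fintype.card_prod, Fintype.card_fin, h3]
  zify [hc]
  linear_combination -h

/-- The matrix with entry `1` at `(0, ε)` and the given other entries. -/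
def normalizedMatrix {R : Type*} [CommRing R] (ε : Fin 2) (x : EntryIndex ε → R) :
    Matrix (Fin 2) (Fin 2) R :=
  Matrix.of fun i j => if hp : (i, j) ≠ (0, ε) then x ⟨(i, j), hp⟩ else 1

/-- The matrix with the columns of the identity matrix at the positions `e (inl _)`, and the
columns of `M` at the positions `e (inr _)`. -/
def chartMatrix {R : Type*} [CommRing R] {c d : ℕ} (e : Fin (c + 1) ⊕ Fin (d - c) ≃ Fin (d + 1))
    (M : Fin (c + 1) × Fin (d - c) → R) : Matrix (Fin (c + 1)) (Fin (d + 1)) R :=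
  Matrix.of fun k m => Sum.elim (fun k' => if k' = k then 1 else 0) (fun l => M (k, l)) (e.symm m)

/-- The coefficients of the incident pair with the given parameters. -/
def chartCoeffs {R : Type*} [CommRing R] {a b c d : ℕ} {ε : Fin 2}
    (e : Fin (c + 1) ⊕ Fin (d - c) ≃ Fin (d + 1)) (x : Param a b c d ε → R) : Coef a b d → R :=
  incidentCoeffs (normalizedMatrix ε fun i => x (Sum.inl i))
    (chartMatrix e fun i => x (Sum.inr (Sum.inl i)))
    (Matrix.of fun i j => x (Sum.inr (Sum.inr (Sum.inl (i, j)))))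
    (Matrix.of fun i j => x (Sum.inr (Sum.inr (Sum.inr (i, j)))))

theorem normalizedMatrix_map {R S : Type*} [CommRing R] [CommRing S] (f : R →+* S) (ε : Fin 2)
    (x : EntryIndex ε → R) :
    (normalizedMatrix ε x).map f = normalizedMatrix ε fun i => f (x i) := by
  ext i j
  simp only [normalizedMatrix, Matrix.map_apply, Matrix.of_apply]
  split_ifs <;> simp

theorem chartMatrix_map {R S : Type*} [CommRing R] [CommRing S] (f : R →+* S) {c d : ℕ}
    (e : Fin (c + 1) ⊕ Fin (d - c) ≃ Fin (d + 1)) (M : Fin (c + 1) × Fin (d - c) → R) :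
    (chartMatrix e M).map f = chartMatrix e fun i => f (M i) := by
  ext k m
  simp only [chartMatrix, Matrix.map_apply, Matrix.of_apply]
  rcases e.symm m with k' | l
  · simp only [Sum.elim_inl]
    split_ifs <;> simp
  · simp

theorem chartCoeffs_map {R S : Type*} [CommRing R] [CommRing S] (f : R →+* S) {a b c d : ℕ}
    {ε : Fin 2} (e : Fin (c + 1) ⊕ Fin (d - c) ≃ Fin (d + 1)) (x : Param a b c d ε → R)
    (i : Coef a b d) : chartCoeffs e (fun j => f (x j)) i = f (chartCoeffs e x i) := by
  rw [chartCoeffs, chartCoeffs, ← incidentCoeffs_map, normalizedMatrix_map, chartMatrix_map]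
  rfl

theorem exists_entry_relation {a b c d : ℕ} (hc : c ≤ d)
    (h : ((a : ℤ) + b - c + 1) * ((d : ℤ) - c) = 3) (ε : Fin 2)
    (e : Fin (c + 1) ⊕ Fin (d - c) ≃ Fin (d + 1)) (p : Fin 2 × Fin 2) :
    ∃ q : Polynomial (MvPolynomial (Coef a b d) ℂ), q ≠ 0 ∧ ∀ x : Param a b c d ε → ℂ,
      (q.map (MvPolynomial.eval (chartCoeffs e x))).eval
        (normalizedMatrix ε (fun i => x (Sum.inl i)) p.1 p.2) = 0 := by
  obtain ⟨q, hq, hq'⟩ := exists_algebraic_relation (card_param ε hc h).le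
    (chartCoeffs e (MvPolynomial.X : Param a b c d ε → MvPolynomial (Param a b c d ε) ℂ))
    (normalizedMatrix ε (fun i => MvPolynomial.X (Sum.inl i)) p.1 p.2)
  refine ⟨q, hq, fun x => ?_⟩
  have h1 := hq' x
  have h2 : (fun i => MvPolynomial.eval x (chartCoeffs e
      (MvPolynomial.X : Param a b c d ε → MvPolynomial (Param a b c d ε) ℂ) i)) =
      chartCoeffs e x := by
    funext i
    rw [← chartCoeffs_map]
    simp
  have h3 := congrFun (congrFun (normalizedMatrix_map (MvPolynomial.eval x) ε
    fun i => MvPolynomial.X (Sum.inl i)) p.1) p.2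
  simp only [Matrix.map_apply, MvPolynomial.eval_X] at h3
  rwa [h2, h3] at h1

/-- Every element of `PGL(2, ℂ)` is represented by a matrix with an entry `1` in its first row. -/
theorem exists_normalized_representative (σ : PGL(2, ℂ)) :
    ∃ (g : GL (Fin 2) ℂ) (ε : Fin 2), Matrix.ProjGenLinGroup.mk g = σ ∧ g.val 0 ε = 1 := by
  obtain ⟨g, rfl⟩ := Matrix.ProjGenLinGroup.mk_surjective σ
  obtain ⟨ε, hε⟩ : ∃ ε, g.val 0 ε ≠ 0 := by
    by_contra! h0
    have hdet := g.det.ne_zero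
    apply hdet
    rw [Matrix.GeneralLinearGroup.val_det_apply, Matrix.det_fin_two, h0 0, h0 1]
    ring
  refine ⟨g * Matrix.GeneralLinearGroup.scalar (Fin 2) (Units.mk0 _ hε)⁻¹, ε, ?_, ?_⟩
  · rw [map_mul, Matrix.ProjGenLinGroup.mk_scalar, mul_one]
  · simp [Matrix.GeneralLinearGroup.scalar, hε]

/-- A pair of frames whose spans are incident along `σ` is in the image of some chart. -/
theorem exists_chartCoeffs_eq {a b c d : ℕ} (hc : c ≤ d) (F : Frame a d × Frame b d)
    (h : GL (Fin 2) ℂ) (ε : Fin 2) (hε : h.val 0 ε = 1)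
    (hF : Module.finrank ℂ ↥(F.1.span.1 ⊔
      translate F.2.span.1 (Matrix.ProjGenLinGroup.mk h⁻¹)) ≤ c + 1) :
    ∃ (e : Fin (c + 1) ⊕ Fin (d - c) ≃ Fin (d + 1)) (x : Param a b c d ε → ℂ),
      chartCoeffs e x = pairCoeffs F ∧ normalizedMatrix ε (fun i => x (Sum.inl i)) = h.val := by
  rw [translate_mk] at hF
  set W := F.1.span.1 ⊔ F.2.span.1.map (substForms d h⁻¹) with hWdef
  obtain ⟨e, M, hM⟩ := exists_chart hc (W.map (coords d).toLinearMap)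
    (by rwa [LinearEquiv.finrank_map_eq])
  have hrow : ∀ f ∈ W, ∀ m, coords d f m =
      ∑ k, coords d f (e (Sum.inl k)) * chartMatrix e M k m := by
    intro f hf m
    obtain ⟨y, rfl⟩ := e.surjective m
    rcases y with k | l
    · simp [chartMatrix]
    · refine (hM _ (Submodule.mem_map_of_mem hf) l).trans ?_
      simp [chartMatrix]
  have hFa : ∀ i, F.1.1 i ∈ W := fun i =>
    Submodule.mem_sup_left (Submodule.subset_span ⟨i, rfl⟩)
  have hFb : ∀ j, substForms d h⁻¹ (F.2.1 j) ∈ W := fun j =>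
    Submodule.mem_sup_right (Submodule.mem_map_of_mem (Submodule.subset_span ⟨j, rfl⟩))
  have hnorm : normalizedMatrix ε (fun i => h.val i.1.1 i.1.2) = h.val := by
    ext i j
    simp only [normalizedMatrix, Matrix.of_apply]
    split_ifs with hp
    · rfl
    · rw [ne_eq, not_not, Prod.mk.injEq] at hp
      rw [hp.1, hp.2, hε]
  -- Relative to the chart basis of W, the coordinates of a form are its pivot coefficients. The
  -- second frame is first moved into W by h⁻¹, and `rho d h` moves it back.
  refine ⟨e, Sum.elim (fun i => h.val i.1.1 i.1.2) (Sum.elim M (Sum.elim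
    (fun p => coords d (F.1.1 p.1) (e (Sum.inl p.2)))
    (fun p => coords d (substForms d h⁻¹ (F.2.1 p.1)) (e (Sum.inl p.2))))), ?_, ?_⟩
  · funext i
    rcases i with ⟨i, m⟩ | ⟨j, m⟩
    · simp only [chartCoeffs, incidentCoeffs, pairCoeffs, Sum.elim_inl, Sum.elim_inr, coord_eq]
      rw [hrow _ (hFa i)]
      rfl
    · simp only [chartCoeffs, incidentCoeffs, pairCoeffs, Sum.elim_inl, Sum.elim_inr, coord_eq]
      rw [hnorm]
      conv_rhs => rw [← substForms_substForms_inv h (F.2.1 j), coords_substForms]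
      rw [Matrix.mul_apply]
      refine Finset.sum_congr rfl fun k _ => ?_
      rw [hrow _ (hFb j)]
      rfl
  · exact hnorm

theorem exists_finite_locus {a b c d : ℕ} (hc : c ≤ d)
    (h : ((a : ℤ) + b - c + 1) * ((d : ℤ) - c) = 3) :
    ∃ P : MvPolynomial (Coef a b d) ℂ, P ≠ 0 ∧ ∀ F : Frame a d × Frame b d,
      MvPolynomial.eval (pairCoeffs F) P ≠ 0 → {σ : PGL(2, ℂ) |
        Module.finrank ℂ ↥(F.1.span.1 ⊔ translate F.2.span.1 σ) ≤ c + 1}.Finite := by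
  classical
  choose q hq0 hq using exists_entry_relation (a := a) (b := b) hc h
  -- A nonvanishing leading coefficient keeps each relation nonzero after specialization at `F`; the
  -- product covers all charts and entries at once.
  refine ⟨∏ ε, ∏ e, ∏ p, (q ε e p).leadingCoeff, ?_, fun F hF => ?_⟩
  · simp only [ne_eq, Finset.prod_eq_zero_iff, not_exists, not_and, Polynomial.leadingCoeff_eq_zero]
    exact fun ε _ e _ p _ => hq0 ε e p
  have hmap : ∀ ε e p, (q ε e p).map (MvPolynomial.eval (pairCoeffs F)) ≠ 0 := by
    intro ε e p h0
    simp only [map_prod, ne_eq, Finset.prod_eq_zero_iff, not_exists, not_and] at hF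
    apply hF ε (Finset.mem_univ _) e (Finset.mem_univ _) p (Finset.mem_univ _)
    have := congrArg (fun f => f.coeff (q ε e p).natDegree) h0
    simpa using this
  let T : Fin 2 × Fin 2 → Set ℂ := fun p =>
    ⋃ ε, ⋃ e, {z | ((q ε e p).map (MvPolynomial.eval (pairCoeffs F))).eval z = 0}
  have hT : ∀ p, (T p).Finite := fun p => Set.finite_iUnion fun ε => Set.finite_iUnion fun e =>
    Polynomial.finite_setOfPred_isRoot (hmap ε e p)
  have hfin : {g : GL (Fin 2) ℂ | ∀ p : Fin 2 × Fin 2, g.val p.1 p.2 ∈ T p}.Finite := by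
    refine ((Set.Finite.pi hT).preimage (f := fun (g : GL (Fin 2) ℂ) p => g.val p.1 p.2) ?_).subset ?_
    · intro g _ g' _ hgg
      ext i j
      exact congrFun hgg (i, j)
    · intro g hg p _
      exact hg p
  refine (hfin.image fun g => (Matrix.ProjGenLinGroup.mk g)⁻¹).subset ?_
  intro σ hσ
  -- The inverse is normalized because the charts apply their matrix to a frame in W to recover the
  -- original V_b.
  obtain ⟨g, ε, hg, hε⟩ := exists_normalized_representative σ⁻¹
  refine ⟨g, fun p => ?_, by simp [hg]⟩
  have hσ' : σ = Matrix.ProjGenLinGroup.mk g⁻¹ := by rw [map_inv, hg, inv_inv]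
  rw [hσ'] at hσ
  obtain ⟨e, x, hx, hx'⟩ := exists_chartCoeffs_eq hc F g ε hε hσ
  have := hq ε e p x
  rw [hx, hx'] at this
  exact Set.mem_iUnion.2 ⟨ε, Set.mem_iUnion.2 ⟨e, this⟩⟩

/-! ### Zariski open sets of pairs of subspaces, seen through frames. -/

/-- The pair of subspaces spanned by a pair of frames. -/
def pairSpan {a b d : ℕ} (F : Frame a d × Frame b d) : Gr a d × Gr b d := (F.1.span, F.2.span)

theorem Frame.span_surjective (a d : ℕ) : Function.Surjective (Frame.span : Frame a d → Gr a d) := by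
  rintro ⟨V, hV⟩
  have := Module.finite_of_finrank_pos (R := ℂ) (M := V) (by omega)
  let B := Module.finBasisOfFinrankEq ℂ V hV
  refine ⟨⟨fun i => (B i : Forms d), B.linearIndependent.map' V.subtype V.ker_subtype⟩, ?_⟩
  apply Subtype.ext
  change Submodule.span ℂ (Set.range fun i => (B i : Forms d)) = V
  have h1 : (Set.range fun i => (B i : Forms d)) = V.subtype '' Set.range B := by
    rw [← Set.range_comp]; rfl
  rw [h1, ← Submodule.map_span, B.span_eq, Submodule.map_top, Submodule.range_subtype]

theorem pairSpan_surjective (a b d : ℕ) :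
    Function.Surjective (pairSpan : Frame a d × Frame b d → Gr a d × Gr b d) := by
  rintro ⟨V, W⟩
  obtain ⟨F, rfl⟩ := Frame.span_surjective a d V
  obtain ⟨G, rfl⟩ := Frame.span_surjective b d W
  exact ⟨(F, G), rfl⟩

theorem isOpen_zariskiFrames {a b d : ℕ} (P : MvPolynomial (Coef a b d) ℂ) :
    @IsOpen _ (zariskiFrames a b d) {F | MvPolynomial.eval (pairCoeffs F) P ≠ 0} := by
  let := zariskiAffine (Coef a b d)
  refine isOpen_induced_iff.2 ⟨{x | MvPolynomial.eval x P ≠ 0}, ?_, rfl⟩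
  exact TopologicalSpace.isOpen_generateFrom_of_mem ⟨P, rfl⟩

/-- Products of polynomials handle finite intersections, so the generating sets form a basis. -/
theorem exists_polynomial_of_isOpen_zariskiAffine {ι : Type} {O : Set (ι → ℂ)}
    (hO : @IsOpen _ (zariskiAffine ι) O) {x : ι → ℂ} (hx : x ∈ O) :
    ∃ P : MvPolynomial ι ℂ, MvPolynomial.eval x P ≠ 0 ∧
      ∀ y, MvPolynomial.eval y P ≠ 0 → y ∈ O := by
  induction hO with
  | basic s hs =>
    obtain ⟨P, rfl⟩ := hs
    exact ⟨P, hx, fun y hy => hy⟩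
  | univ => exact ⟨1, by simp, fun y _ => trivial⟩
  | inter s t _ _ hs ht =>
    obtain ⟨P, hP, hP'⟩ := hs hx.1
    obtain ⟨Q, hQ, hQ'⟩ := ht hx.2
    refine ⟨P * Q, by simp [hP, hQ], fun y hy => ?_⟩
    rw [map_mul, mul_ne_zero_iff] at hy
    exact ⟨hP' y hy.1, hQ' y hy.2⟩
  | sUnion S _ hS =>
    obtain ⟨s, hs, hxs⟩ := hx
    obtain ⟨P, hP, hP'⟩ := hS s hs hxs
    exact ⟨P, hP, fun y hy => ⟨s, hs, hP' y hy⟩⟩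

theorem exists_polynomial_of_isOpen_zariskiGr {a b d : ℕ} {O : Set (Gr a d × Gr b d)}
    (hO : @IsOpen _ (zariskiGr a b d) O) (hne : O.Nonempty) :
    ∃ (P : MvPolynomial (Coef a b d) ℂ) (F₀ : Frame a d × Frame b d),
      MvPolynomial.eval (pairCoeffs F₀) P ≠ 0 ∧
      ∀ F, MvPolynomial.eval (pairCoeffs F) P ≠ 0 → pairSpan F ∈ O := by
  obtain ⟨V, hV⟩ := hne
  obtain ⟨F₀, rfl⟩ := pairSpan_surjective a b d V
  let := zariskiAffine (Coef a b d)
  obtain ⟨O', hO', hpre⟩ := isOpen_induced_iff.1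
    (isOpen_coinduced.1 hO : @IsOpen _ (zariskiFrames a b d) (pairSpan ⁻¹' O))
  have hmem : ∀ F, pairCoeffs F ∈ O' ↔ pairSpan F ∈ O := fun F => Set.ext_iff.1 hpre F
  obtain ⟨P, hP, hP'⟩ := exists_polynomial_of_isOpen_zariskiAffine hO' ((hmem F₀).2 hV)
  exact ⟨P, F₀, hP, fun F hF => (hmem F).1 (hP' _ hF)⟩

/-- A nonzero polynomial does not vanish identically on a nonempty open set. -/
theorem exists_eval_ne_zero_of_mem_nhds {ι : Type} [Fintype ι] {P : MvPolynomial ι ℂ} (hP : P ≠ 0)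
    {y₀ : ι → ℂ} {S : Set (ι → ℂ)} (hS : S ∈ nhds y₀) : ∃ y ∈ S, MvPolynomial.eval y P ≠ 0 := by
  obtain ⟨r, hr, hball⟩ := Metric.mem_nhds_iff.1 hS
  by_contra! h0
  apply hP
  refine MvPolynomial.funext_set (fun i => Metric.ball (y₀ i) r) (fun i => ?_) fun x hx => ?_
  · exact (infinite_of_mem_nhds (y₀ i) (Metric.ball_mem_nhds _ hr))
  · rw [map_zero]
    apply h0 x (hball _)
    rw [ball_pi _ hr]
    exact hx

theorem linearIndependent_coords {a d : ℕ} (F : Frame a d) :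
    LinearIndependent ℂ (fun i k => F.coord (i, k)) :=
  F.2.map' (coords d).toLinearMap (coords d).ker

theorem exists_pairCoeffs_eq {a b d : ℕ} (y : Coef a b d → ℂ)
    (h₁ : LinearIndependent ℂ fun (i : Fin (a + 1)) (k : Fin (d + 1)) => y (Sum.inl (i, k)))
    (h₂ : LinearIndependent ℂ fun (i : Fin (b + 1)) (k : Fin (d + 1)) => y (Sum.inr (i, k))) :
    ∃ F : Frame a d × Frame b d, pairCoeffs F = y := by
  refine ⟨(⟨_, h₁.map' (coords d).symm.toLinearMap (coords d).symm.ker⟩,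
    ⟨_, h₂.map' (coords d).symm.toLinearMap (coords d).symm.ker⟩), ?_⟩
  funext i
  rcases i with ⟨i, k⟩ | ⟨i, k⟩ <;> simp [pairCoeffs, coord_eq]

/-- Linear independence is an open condition in the Euclidean topology. -/
theorem eventually_exists_pairCoeffs_eq {a b d : ℕ} (F₀ : Frame a d × Frame b d) :
    ∀ᶠ y in nhds (pairCoeffs F₀), ∃ F : Frame a d × Frame b d, pairCoeffs F = y := by
  have h₁ : ∀ᶠ y : Coef a b d → ℂ in nhds (pairCoeffs F₀), LinearIndependent ℂ
      fun (i : Fin (a + 1)) (k : Fin (d + 1)) => y (Sum.inl (i, k)) := by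
    have hc : Continuous fun (y : Coef a b d → ℂ) (i : Fin (a + 1)) (k : Fin (d + 1)) =>
      y (Sum.inl (i, k)) := by fun_prop
    exact (hc.tendsto (pairCoeffs F₀)).eventually (linearIndependent_coords F₀.1).eventually
  have h₂ : ∀ᶠ y : Coef a b d → ℂ in nhds (pairCoeffs F₀), LinearIndependent ℂ
      fun (i : Fin (b + 1)) (k : Fin (d + 1)) => y (Sum.inr (i, k)) := by
    have hc : Continuous fun (y : Coef a b d → ℂ) (i : Fin (b + 1)) (k : Fin (d + 1)) =>
      y (Sum.inr (i, k)) := by fun_prop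
    exact (hc.tendsto (pairCoeffs F₀)).eventually (linearIndependent_coords F₀.2).eventually
  filter_upwards [h₁, h₂] with y hy₁ hy₂ using exists_pairCoeffs_eq y hy₁ hy₂

theorem exists_frames_eval_ne_zero {a b d : ℕ} (F₀ : Frame a d × Frame b d)
    {P : MvPolynomial (Coef a b d) ℂ} (hP : P ≠ 0) :
    ∃ F : Frame a d × Frame b d, MvPolynomial.eval (pairCoeffs F) P ≠ 0 := by
  obtain ⟨y, ⟨F, rfl⟩, hy⟩ := exists_eval_ne_zero_of_mem_nhds hP (eventually_exists_pairCoeffs_eq F₀)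
  exact ⟨F, hy⟩

/-- The frame obtained from `F` by a change of basis of its span. -/
def Frame.transform {a d : ℕ} (F : Frame a d) (A : Fin (a + 1) → Fin (a + 1) → ℂ)
    (hA : LinearIndependent ℂ A) : Frame a d :=
  ⟨fun i => ∑ j, A i j • F.1 j,
    hA.map' (Fintype.linearCombination ℂ F.1) (LinearMap.ker_eq_bot.2
      (linearIndependent_iff_injective_fintypeLinearCombination.1 F.2))⟩

theorem Frame.coord_transform {a d : ℕ} (F : Frame a d) (A : Fin (a + 1) → Fin (a + 1) → ℂ)
    (hA : LinearIndependent ℂ A) (i : Fin (a + 1)) (k : Fin (d + 1)) :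
    (F.transform A hA).coord (i, k) = ∑ j, A i j * F.coord (j, k) := by
  simp [coord_eq, Frame.transform]

theorem Frame.span_transform {a d : ℕ} (F : Frame a d) (A : Fin (a + 1) → Fin (a + 1) → ℂ)
    (hA : LinearIndependent ℂ A) : (F.transform A hA).span = F.span := by
  apply Subtype.ext
  apply Submodule.eq_of_le_of_finrank_eq
  · refine Submodule.span_le.2 ?_
    rintro _ ⟨i, rfl⟩
    change ∑ j, A i j • F.1 j ∈ F.span.1
    exact Submodule.sum_mem _ fun j _ => Submodule.smul_mem _ _ (Submodule.subset_span (Set.mem_range_self j))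
  · rw [(F.transform A hA).span.2, F.span.2]

theorem Frame.exists_transform_eq {a d : ℕ} {F G : Frame a d} (h : F.span = G.span) :
    ∃ A hA, F.transform A hA = G := by
  have hmem : ∀ i, ∃ A : Fin (a + 1) → ℂ, ∑ j, A j • F.1 j = G.1 i := by
    intro i
    rw [← Submodule.mem_span_range_iff_exists_fun]
    have h1 : G.1 i ∈ G.span.1 := Submodule.subset_span ⟨i, rfl⟩
    rwa [← h] at h1
  choose A hA using hmem
  have hind : LinearIndependent ℂ A := by
    apply LinearIndependent.of_comp (Fintype.linearCombination ℂ F.1)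
    have : (Fintype.linearCombination ℂ F.1) ∘ A = G.1 := funext hA
    rw [this]
    exact G.2
  exact ⟨A, hind, Subtype.ext (funext hA)⟩

/-- The pairs of subspaces having a pair of frames at which `P` does not vanish. -/
def nonvanishingLocus {a b d : ℕ} (P : MvPolynomial (Coef a b d) ℂ) : Set (Gr a d × Gr b d) :=
  pairSpan '' {F | MvPolynomial.eval (pairCoeffs F) P ≠ 0}

theorem isOpen_nonvanishingLocus {a b d : ℕ} (P : MvPolynomial (Coef a b d) ℂ) :
    @IsOpen _ (zariskiGr a b d) (nonvanishingLocus P) := by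
  let := zariskiFrames a b d
  refine isOpen_coinduced.2 (isOpen_iff_forall_mem_open.2 ?_)
  rintro F ⟨G, hG, hGF⟩
  obtain ⟨A, hA, hAG⟩ := Frame.exists_transform_eq (congrArg Prod.fst hGF).symm
  obtain ⟨B, hB, hBG⟩ := Frame.exists_transform_eq (congrArg Prod.snd hGF).symm
  -- A change of bases is a linear substitution in the coefficients. Thus the preimage of the locus
  -- is a union of nonvanishing sets of the polynomials `bind₁ y P`.
  let y : Coef a b d → MvPolynomial (Coef a b d) ℂ := Sum.elim
    (fun p => ∑ j, MvPolynomial.C (A p.1 j) * MvPolynomial.X (Sum.inl (j, p.2)))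
    (fun p => ∑ j, MvPolynomial.C (B p.1 j) * MvPolynomial.X (Sum.inr (j, p.2)))
  have hy : ∀ H : Frame a d × Frame b d, MvPolynomial.eval (pairCoeffs H) (MvPolynomial.bind₁ y P) =
      MvPolynomial.eval (pairCoeffs (H.1.transform A hA, H.2.transform B hB)) P := by
    intro H
    rw [MvPolynomial.eval, MvPolynomial.eval₂Hom_bind₁]
    congr 2
    funext i
    rcases i with ⟨i, k⟩ | ⟨i, k⟩ <;>
      simp [y, pairCoeffs, Frame.coord_transform]
  refine ⟨{H | MvPolynomial.eval (pairCoeffs H) (MvPolynomial.bind₁ y P) ≠ 0}, ?_,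
    isOpen_zariskiFrames _, ?_⟩
  · intro H hH
    refine ⟨(H.1.transform A hA, H.2.transform B hB), ?_, ?_⟩
    · rw [Set.mem_ofPred_eq, ← hy]
      exact hH
    · simp only [pairSpan, Frame.span_transform]
  · change MvPolynomial.eval _ _ ≠ 0
    rw [hy, hAG, hBG]
    exact hG

theorem dense_nonvanishingLocus {a b d : ℕ} {P : MvPolynomial (Coef a b d) ℂ} (hP : P ≠ 0) :
    @Dense _ (zariskiGr a b d) (nonvanishingLocus P) := by
  let := zariskiGr a b d
  rw [dense_iff_inter_open]
  intro O hO hne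
  obtain ⟨Q, F₀, hF₀, hQ⟩ := exists_polynomial_of_isOpen_zariskiGr hO hne
  have hQ0 : Q ≠ 0 := by
    rintro rfl
    simp at hF₀
  obtain ⟨F, hF⟩ := exists_frames_eval_ne_zero F₀ (mul_ne_zero hP hQ0)
  rw [map_mul, mul_ne_zero_iff] at hF
  exact ⟨pairSpan F, hQ F hF.2, F, hF.1, rfl⟩

theorem exists_frame {a d : ℕ} (ha : a ≤ d) : Nonempty (Frame a d) :=
  ⟨⟨fun i => (coords d).symm (Pi.single (Fin.castLE (by omega) i) 1), by
    have h1 : LinearIndependent ℂ fun i : Fin (d + 1) => (Pi.single i 1 : Fin (d + 1) → ℂ) := by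
      convert (Pi.basisFun ℂ (Fin (d + 1))).linearIndependent with i
      simp
    exact (h1.map' (coords d).symm.toLinearMap (coords d).symm.ker).comp _
      (Fin.castLE_injective _)⟩⟩

theorem nonvanishingLocus_nonempty {a b d : ℕ} (ha : a ≤ d) (hb : b ≤ d)
    {P : MvPolynomial (Coef a b d) ℂ} (hP : P ≠ 0) : (nonvanishingLocus P).Nonempty := by
  obtain ⟨F⟩ := exists_frame ha
  obtain ⟨G⟩ := exists_frame hb
  obtain ⟨H, hH⟩ := exists_frames_eval_ne_zero (F, G) hP
  exact ⟨_, H, hH, rfl⟩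

theorem exists_open_finite {a b c d : ℕ} (ha : a ≤ d) (hb : b ≤ d) (hc : c ≤ d)
    (h : ((a : ℤ) + b - c + 1) * ((d : ℤ) - c) = 3) :
    ∃ U : Set (Gr a d × Gr b d), @IsOpen _ (zariskiGr a b d) U ∧ U.Nonempty ∧
      @Dense _ (zariskiGr a b d) U ∧ ∀ V ∈ U, {σ : PGL(2, ℂ) |
        Module.finrank ℂ ↥(V.1.1 ⊔ translate V.2.1 σ) ≤ c + 1}.Finite := by
  obtain ⟨P, hP, hfin⟩ := exists_finite_locus (a := a) (b := b) hc h
  refine ⟨nonvanishingLocus P, isOpen_nonvanishingLocus P, nonvanishingLocus_nonempty ha hb hP,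
    dense_nonvanishingLocus hP, ?_⟩
  rintro _ ⟨F, hF, rfl⟩
  exact hfin F hF

/-! ### The differential of the parametrization of incident pairs. -/

/-- Both V_a and the translate of V_b lie in the span of the c + 1 rows of `w`. -/
theorem finrank_le_of_pairCoeffs_eq {a b c d : ℕ} {F : Frame a d × Frame b d} {h : GL (Fin 2) ℂ}
    {w : Matrix (Fin (c + 1)) (Fin (d + 1)) ℂ} {A : Matrix (Fin (a + 1)) (Fin (c + 1)) ℂ}
    {B : Matrix (Fin (b + 1)) (Fin (c + 1)) ℂ}
    (hF : pairCoeffs F = incidentCoeffs h.val w A B) :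
    Module.finrank ℂ ↥(F.1.span.1 ⊔ translate F.2.span.1 (Matrix.ProjGenLinGroup.mk h⁻¹)) ≤ c + 1 := by
  let f : Fin (c + 1) → Forms d := fun k => (coords d).symm (w k)
  have hcomb : ∀ {n : ℕ} (C : Matrix (Fin n) (Fin (c + 1)) ℂ) (i : Fin n),
      (coords d).symm ((C * w) i) ∈ Submodule.span ℂ (Set.range f) := by
    intro n C i
    have h1 : (C * w) i = ∑ k, C i k • w k := by
      funext m
      simp [Matrix.mul_apply]
    rw [h1, map_sum]
    refine Submodule.sum_mem _ fun k _ => ?_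
    rw [map_smul]
    exact Submodule.smul_mem _ _ (Submodule.subset_span ⟨k, rfl⟩)
  have hle : F.1.span.1 ⊔ translate F.2.span.1 (Matrix.ProjGenLinGroup.mk h⁻¹) ≤
      Submodule.span ℂ (Set.range f) := by
    refine sup_le (Submodule.span_le.2 ?_) ?_
    · rintro _ ⟨i, rfl⟩
      have h1 : F.1.1 i = (coords d).symm ((A * w) i) := by
        rw [LinearEquiv.eq_symm_apply]
        funext m
        exact congrFun hF (Sum.inl (i, m))
      rw [h1]
      exact hcomb A i
    · rw [translate_mk, Submodule.map_le_iff_le_comap]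
      refine Submodule.span_le.2 ?_
      rintro _ ⟨j, rfl⟩
      have h1 : F.2.1 j = substForms d h ((coords d).symm ((B * w) j)) := by
        apply (coords d).injective
        rw [coords_substForms, LinearEquiv.apply_symm_apply]
        funext m
        exact congrFun hF (Sum.inr (j, m))
      rw [SetLike.mem_coe, Submodule.mem_comap, h1, substForms_inv_substForms]
      exact hcomb B j
  refine (Submodule.finrank_mono hle).trans ?_
  exact (finrank_range_le_card (R := ℂ) f).trans_eq (by simp)

/-- The coefficients of the polynomial-valued function `f` have as derivatives at `0` the
coefficients of `f'`. -/
def HasCoeffDeriv (f : ℂ → Polynomial ℂ) (f' : Polynomial ℂ) : Prop :=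
  ∀ m, HasDerivAt (fun τ => (f τ).coeff m) (f'.coeff m) 0

theorem HasCoeffDeriv.mul {f g : ℂ → Polynomial ℂ} {f' g' : Polynomial ℂ}
    (hf : HasCoeffDeriv f f') (hg : HasCoeffDeriv g g') :
    HasCoeffDeriv (fun τ => f τ * g τ) (f' * g 0 + f 0 * g') := by
  intro m
  simp only [Polynomial.coeff_add, Polynomial.coeff_mul, ← Finset.sum_add_distrib]
  exact HasDerivAt.fun_sum fun p _ => (hf p.1).mul (hg p.2)

theorem HasCoeffDeriv.pow {f : ℂ → Polynomial ℂ} {f' : Polynomial ℂ}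
    (hf : HasCoeffDeriv f f') (n : ℕ) :
    HasCoeffDeriv (fun τ => f τ ^ n) ((n : Polynomial ℂ) * f 0 ^ (n - 1) * f') := by
  induction n with
  | zero => intro m; simpa using hasDerivAt_const (0 : ℂ) ((1 : Polynomial ℂ).coeff m)
  | succ n ih =>
    have := ih.mul hf
    simp only [← pow_succ] at this
    convert this using 1
    rcases n with _ | n
    · simp
    · rw [show n + 1 + 1 - 1 = n + 1 from rfl, show n + 1 - 1 = n from rfl]
      push_cast
      ring

theorem hasCoeffDeriv_linear (p q : Polynomial ℂ) :
    HasCoeffDeriv (fun τ => p + Polynomial.C τ * q) q := by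
  intro m
  simp only [Polynomial.coeff_add, Polynomial.coeff_C_mul]
  simpa using ((hasDerivAt_id (0 : ℂ)).mul_const (q.coeff m)).const_add (p.coeff m)

/-- The derivative of `rho d` at the identity in the direction of the matrix `(z, y; x, 0)`. -/
def dRho (d : ℕ) (x y z : ℂ) : Matrix (Fin (d + 1)) (Fin (d + 1)) ℂ :=
  Matrix.of fun k m => (if (m : ℕ) = k then ((d : ℂ) - (k : ℕ)) * z else 0) +
    (if (m : ℕ) = k + 1 then ((d : ℂ) - (k : ℕ)) * y else 0) +
    (if (m : ℕ) + 1 = k then ((k : ℕ) : ℂ) * x else 0)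

/-- Setting s = 1 and t = X, row k is (1 + τ(z + yX))^(d-k) (X + τx)^k, and the product rule
applies. Three directions suffice, as scalar matrices act on forms by scalars. -/
theorem hasDerivAt_rho (d : ℕ) (x y z : ℂ) (k m : Fin (d + 1)) :
    HasDerivAt (fun τ : ℂ => rho d (Matrix.of ![![1 + τ * z, τ * y], ![τ * x, 1]]) k m)
      (dRho d x y z k m) 0 := by
  have h1 := ((hasCoeffDeriv_linear 1 (Polynomial.C z + Polynomial.C y * Polynomial.X)).pow
    (d - (k : ℕ))).mul ((hasCoeffDeriv_linear Polynomial.X (Polynomial.C x)).pow (k : ℕ)) m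
  refine (h1.congr_deriv ?_).congr_of_eventuallyEq (Filter.Eventually.of_forall fun τ => ?_)
  · have h3 : ((d - (k : ℕ) : ℕ) : ℂ) = (d : ℂ) - ((k : ℕ) : ℂ) := by
      rw [Nat.cast_sub (by omega)]
    have h4 : ((((d - (k : ℕ) : ℕ) : Polynomial ℂ) * (1 + Polynomial.C 0 *
          (Polynomial.C z + Polynomial.C y * Polynomial.X)) ^ (d - (k : ℕ) - 1) *
          (Polynomial.C z + Polynomial.C y * Polynomial.X)) *
          (Polynomial.X + Polynomial.C 0 * Polynomial.C x) ^ (k : ℕ) +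
        (1 + Polynomial.C 0 * (Polynomial.C z + Polynomial.C y * Polynomial.X)) ^ (d - (k : ℕ)) *
          (((k : ℕ) : Polynomial ℂ) * (Polynomial.X + Polynomial.C 0 * Polynomial.C x) ^
            ((k : ℕ) - 1) * Polynomial.C x)) =
        Polynomial.C (((d : ℂ) - (k : ℕ)) * z) * Polynomial.X ^ (k : ℕ) +
          Polynomial.C (((d : ℂ) - (k : ℕ)) * y) * Polynomial.X ^ ((k : ℕ) + 1) +
          Polynomial.C (((k : ℕ) : ℂ) * x) * Polynomial.X ^ ((k : ℕ) - 1) := by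
      rw [← h3]
      simp only [map_zero, zero_mul, add_zero, one_pow, map_mul, map_natCast]
      ring
    rw [h4]
    simp only [Polynomial.coeff_add, Polynomial.coeff_C_mul, Polynomial.coeff_X_pow, dRho,
      Matrix.of_apply, mul_ite, mul_one, mul_zero]
    congr 1
    -- For k = 0 the truncated exponent k - 1 is harmless, since its coefficient contains the factor
    -- k.
    rcases hk : (k : ℕ) with _ | n
    · simp
    · simp
  · simp only [rho_apply, Matrix.of_apply, Matrix.cons_val_zero, Matrix.cons_val_one]
    congr 3
    · simp only [map_add, map_mul, map_one]; ring
    · simp only [map_mul, map_one]; ring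

theorem rho_one {R : Type*} [CommRing R] (d : ℕ) : rho d (1 : Matrix (Fin 2) (Fin 2) R) = 1 := by
  ext k m
  simp [rho_apply, Polynomial.coeff_X_pow, Matrix.one_apply, Fin.ext_iff, eq_comm]

/-- Parameters for incident pairs of frames: a change of coordinates, a frame of a
`(c + 1)`-dimensional space, and coefficients with respect to that frame. -/
abbrev IncidenceSpace (b c d : ℕ) : Type :=
  (Fin 2 → Fin 2 → ℂ) × (Fin (c + 1) → Fin (d + 1) → ℂ) × (Fin (b + 1) → Fin (c + 1) → ℂ)

/-- The parametrization of incident pairs of frames. -/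
def incidenceMap {a b c d : ℕ} (A : Matrix (Fin (a + 1)) (Fin (c + 1)) ℂ)
    (p : IncidenceSpace b c d) : Coef a b d → ℂ :=
  incidentCoeffs (Matrix.of p.1) (Matrix.of p.2.1) A (Matrix.of p.2.2)

theorem contDiff_rho (d : ℕ) (k m : Fin (d + 1)) :
    ContDiff ℂ 1 fun h : Fin 2 → Fin 2 → ℂ => rho d (Matrix.of h) k m := by
  let P : MvPolynomial (Fin 2 × Fin 2) ℂ :=
    rho d (Matrix.of fun i j => (MvPolynomial.X (i, j) : MvPolynomial (Fin 2 × Fin 2) ℂ)) k m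
  have h1 : (fun h : Fin 2 → Fin 2 → ℂ => rho d (Matrix.of h) k m) =
      fun h => MvPolynomial.eval (fun p : Fin 2 × Fin 2 => h p.1 p.2) P := by
    funext h
    have := rho_map (MvPolynomial.eval (fun p : Fin 2 × Fin 2 => h p.1 p.2)) d
      (Matrix.of fun i j => (MvPolynomial.X (i, j) : MvPolynomial (Fin 2 × Fin 2) ℂ))
    have h2 := congrFun (congrFun this k) m
    rw [Matrix.map_apply] at h2
    rw [← h2]
    congr 2
    ext i j
    simp
  rw [h1]
  have h2 : ContDiff ℂ 1 fun x : Fin 2 × Fin 2 → ℂ => MvPolynomial.eval x P :=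
    (AnalyticOnNhd.eval_mvPolynomial P).contDiff
  exact h2.comp (by fun_prop)

theorem contDiff_incidenceMap {a b c d : ℕ} (A : Matrix (Fin (a + 1)) (Fin (c + 1)) ℂ) :
    ContDiff ℂ 1 (incidenceMap A : IncidenceSpace b c d → Coef a b d → ℂ) := by
  rw [contDiff_pi]
  rintro (⟨i, m⟩ | ⟨j, m⟩)
  · simp only [incidenceMap, incidentCoeffs, Sum.elim_inl, Matrix.mul_apply, Matrix.of_apply]
    fun_prop
  · simp only [incidenceMap, incidentCoeffs, Sum.elim_inr, Matrix.mul_apply, Matrix.of_apply]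
    refine ContDiff.sum fun k _ => ContDiff.mul (by fun_prop) ((contDiff_rho d k m).comp contDiff_fst)

/-- The incident pairs of frames near a given one fill a neighbourhood, provided that the
differential of the parametrization is surjective. -/
theorem map_nhds_incidenceMap {a b c d : ℕ} (A : Matrix (Fin (a + 1)) (Fin (c + 1)) ℂ)
    (B : Matrix (Fin (b + 1)) (Fin (c + 1)) ℂ) (w : Matrix (Fin (c + 1)) (Fin (d + 1)) ℂ)
    (hsurj : ∀ u : Coef a b d → ℂ, ∃ (δw : Matrix (Fin (c + 1)) (Fin (d + 1)) ℂ)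
      (δB : Matrix (Fin (b + 1)) (Fin (c + 1)) ℂ) (x y z : ℂ),
      (∀ i m, (A * δw) i m = u (Sum.inl (i, m))) ∧
      ∀ j m, (B * δw + δB * w + B * w * dRho d x y z) j m = u (Sum.inr (j, m))) :
    Filter.map (incidenceMap A) (nhds ((1 : Matrix (Fin 2) (Fin 2) ℂ), w, B)) =
      nhds (incidenceMap A ((1 : Matrix (Fin 2) (Fin 2) ℂ), w, B)) := by
  set p₀ : IncidenceSpace b c d := ((1 : Matrix (Fin 2) (Fin 2) ℂ), w, B) with hp₀
  have hf := (contDiff_incidenceMap (b := b) (d := d) A).contDiffAt (x := p₀)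
    |>.hasStrictFDerivAt one_ne_zero
  refine hf.map_nhds_eq_of_surj (LinearMap.range_eq_top.2 fun u => ?_)
  obtain ⟨δw, δB, x, y, z, h₁, h₂⟩ := hsurj u
  -- Differentiating along a straight line through `p₀` identifies the value of the differential
  -- with the expression in `hsurj`.
  let H : ℂ → Fin 2 → Fin 2 → ℂ := fun τ => ![![1 + τ * z, τ * y], ![τ * x, 1]]
  let W : ℂ → Matrix (Fin (c + 1)) (Fin (d + 1)) ℂ := fun τ i j => w i j + τ * δw i j
  let C : ℂ → Matrix (Fin (b + 1)) (Fin (c + 1)) ℂ := fun τ i j => B i j + τ * δB i j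
  let γ : ℂ → IncidenceSpace b c d := fun τ => (H τ, W τ, C τ)
  have hW₀ : W 0 = w := by ext; simp [W]
  have hC₀ : C 0 = B := by ext; simp [C]
  have hH : HasDerivAt H ![![z, y], ![x, 0]] 0 := by
    rw [hasDerivAt_pi]
    intro i
    rw [hasDerivAt_pi]
    intro j
    fin_cases i <;> fin_cases j
    · simpa [H] using ((hasDerivAt_id (0 : ℂ)).mul_const z).const_add 1
    · simpa [H] using (hasDerivAt_id (0 : ℂ)).mul_const y
    · simpa [H] using (hasDerivAt_id (0 : ℂ)).mul_const x
    · simpa [H] using hasDerivAt_const (0 : ℂ) (1 : ℂ)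
  have hW : ∀ i j, HasDerivAt (fun τ => W τ i j) (δw i j) 0 := fun i j => by
    simpa [W] using ((hasDerivAt_id (0 : ℂ)).mul_const (δw i j)).const_add (w i j)
  have hC : ∀ i j, HasDerivAt (fun τ => C τ i j) (δB i j) 0 := fun i j => by
    simpa [C] using ((hasDerivAt_id (0 : ℂ)).mul_const (δB i j)).const_add (B i j)
  have hγ : HasDerivAt γ (![![z, y], ![x, 0]], δw, δB) 0 := hH.prodMk
    ((hasDerivAt_pi.2 fun i => hasDerivAt_pi.2 (hW i)).prodMk
      (hasDerivAt_pi.2 fun i => hasDerivAt_pi.2 (hC i)))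
  have hγ₀ : γ 0 = p₀ := by
    refine Prod.ext ?_ (Prod.ext hW₀ hC₀)
    ext i j
    fin_cases i <;> fin_cases j <;> simp [γ, H, hp₀]
  have hcomp : HasDerivAt (fun τ => incidenceMap A (γ τ))
      (fderiv ℂ (incidenceMap A) p₀ (![![z, y], ![x, 0]], δw, δB)) 0 := by
    have := hf.hasFDerivAt
    rw [← hγ₀] at this ⊢
    exact this.comp_hasDerivAt 0 hγ
  refine ⟨(![![z, y], ![x, 0]], δw, δB), hcomp.unique ?_⟩
  rw [hasDerivAt_pi]
  rintro (⟨i, m⟩ | ⟨j, m⟩)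
  · rw [← h₁ i m]
    change HasDerivAt (fun τ : ℂ => (A * W τ) i m) _ 0
    simp only [Matrix.mul_apply]
    exact HasDerivAt.fun_sum fun k _ => (hW k m).const_mul _
  · rw [← h₂ j m]
    change HasDerivAt (fun τ : ℂ => (C τ * W τ * rho d (Matrix.of (H τ))) j m) _ 0
    have hBw : ∀ m, HasDerivAt (fun τ : ℂ => (C τ * W τ) j m)
        ((B * δw + δB * w) j m) 0 := by
      intro m
      have : HasDerivAt (fun τ : ℂ => ∑ k, C τ j k * W τ k m) _ 0 :=
        HasDerivAt.fun_sum fun k _ => (hC j k).mul (hW k m)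
      simp only [Matrix.mul_apply]
      refine this.congr_deriv ?_
      simp only [Matrix.add_apply, Matrix.mul_apply, ← Finset.sum_add_distrib, hW₀, hC₀]
      exact Finset.sum_congr rfl fun k _ => add_comm _ _
    have hρ₀ : rho d (Matrix.of (H 0)) = 1 := by
      rw [← rho_one]
      congr 1
      ext i j
      fin_cases i <;> fin_cases j <;> simp [H]
    have : HasDerivAt (fun τ : ℂ => ∑ k, (C τ * W τ) j k *
        rho d (Matrix.of (H τ)) k m) _ 0 :=
      HasDerivAt.fun_sum fun k _ => (hBw k).mul (hasDerivAt_rho d x y z k m)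
    refine (this.congr_deriv ?_).congr_of_eventuallyEq
      (Filter.Eventually.of_forall fun τ => Matrix.mul_apply)
    rw [Finset.sum_add_distrib]
    simp only [hW₀, hC₀, hρ₀]
    rw [← Matrix.mul_apply, ← Matrix.mul_apply, Matrix.mul_one]
    rfl

/-- Incident pairs are dense as soon as the parametrization of incident pairs of frames has
surjective differential at some pair of frames. -/
theorem dense_of_surjective {a b c d : ℕ} (A : Matrix (Fin (a + 1)) (Fin (c + 1)) ℂ)
    (B : Matrix (Fin (b + 1)) (Fin (c + 1)) ℂ) (w : Matrix (Fin (c + 1)) (Fin (d + 1)) ℂ)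
    (hA : LinearIndependent ℂ (A * w).row) (hB : LinearIndependent ℂ (B * w).row)
    (hsurj : ∀ u : Coef a b d → ℂ, ∃ (δw : Matrix (Fin (c + 1)) (Fin (d + 1)) ℂ)
      (δB : Matrix (Fin (b + 1)) (Fin (c + 1)) ℂ) (x y z : ℂ),
      (∀ i m, (A * δw) i m = u (Sum.inl (i, m))) ∧
      ∀ j m, (B * δw + δB * w + B * w * dRho d x y z) j m = u (Sum.inr (j, m))) :
    @Dense _ (zariskiGr a b d) (Prod.snd '' incidence a b c d) := by
  let _ := zariskiGr a b d
  rw [dense_iff_inter_open]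
  intro O hO hne
  obtain ⟨Q, F₁, hF₁, hQ⟩ := exists_polynomial_of_isOpen_zariskiGr hO hne
  have hQ0 : Q ≠ 0 := by
    rintro rfl
    simp at hF₁
  have hmap := map_nhds_incidenceMap A B w hsurj
  set p₀ : IncidenceSpace b c d := ((1 : Matrix (Fin 2) (Fin 2) ℂ), w, B) with hp₀
  obtain ⟨F₀, hF₀⟩ : ∃ F : Frame a d × Frame b d, pairCoeffs F = incidenceMap A p₀ := by
    apply exists_pairCoeffs_eq
    · exact hA
    · have : (B * w * rho d (1 : Matrix (Fin 2) (Fin 2) ℂ)) = B * w := by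
        rw [rho_one, Matrix.mul_one]
      rw [← this] at hB
      exact hB
  have hdet : ∀ᶠ p : IncidenceSpace b c d in nhds p₀, (Matrix.of p.1).det ≠ 0 := by
    have hcont : Continuous fun p : IncidenceSpace b c d => (Matrix.of p.1).det := by
      simp only [Matrix.det_fin_two, Matrix.of_apply]
      fun_prop
    refine hcont.continuousAt.eventually_ne ?_
    change (1 : Matrix (Fin 2) (Fin 2) ℂ).det ≠ 0
    simp
  -- Restricting to invertible matrices keeps a neighbourhood and ensures that the points found come
  -- from PGL(2).
  have himage : incidenceMap A '' {p : IncidenceSpace b c d | (Matrix.of p.1).det ≠ 0} ∈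
      nhds (pairCoeffs F₀) := by
    rw [hF₀, ← hmap]
    exact Filter.image_mem_map hdet
  obtain ⟨y, ⟨⟨p, hp, rfl⟩, F, hF⟩, hy⟩ := exists_eval_ne_zero_of_mem_nhds hQ0
    (Filter.inter_mem himage (eventually_exists_pairCoeffs_eq F₀))
  rw [← hF] at hy
  let h : GL (Fin 2) ℂ := Matrix.GeneralLinearGroup.mkOfDetNeZero (Matrix.of p.1) hp
  refine ⟨pairSpan F, hQ F hy, (Matrix.ProjGenLinGroup.mk h⁻¹, pairSpan F), ?_, rfl⟩
  exact finrank_le_of_pairCoeffs_eq (h := h) hF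

/-! ### Reduction to a tangent condition, and the two explicit cases. -/

/-- Incident pairs are dense if, for a basis `w` of some `(c + 1)`-dimensional space `W` of forms,
the infinitesimal changes of coordinates span the homomorphisms from the span of the first `r`
elements of `w` to the quotient by `W`. -/
theorem dense_of_tangent {a b c d r : ℕ} (hac : a ≤ c) (hrc : r + c = a + b + 1) (hra : r ≤ a + 1)
    (w : Matrix (Fin (c + 1)) (Fin (d + 1)) ℂ) (pivot : Fin (c + 1) → Fin (d + 1))
    (hw : ∀ i k, w i (pivot k) = if i = k then 1 else 0)
    (htan : ∀ δ : ℕ → ℕ → ℂ, ∃ x y z : ℂ, ∀ j : Fin (c + 1), (j : ℕ) < r →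
      ∃ μ : Fin (c + 1) → ℂ, ∀ m, ∑ k, μ k * w k m = δ j m - (w * dRho d x y z) j m) :
    @Dense _ (zariskiGr a b d) (Prod.snd '' incidence a b c d) := by
  have hind : LinearIndependent ℂ w.row := by
    rw [Fintype.linearIndependent_iff]
    intro g hg k
    have := congrFun hg (pivot k)
    simpa [hw] using this
  -- V_a gets the first a + 1 basis vectors; V_b gets the first r of them and all those after index
  -- a, so the two share exactly r.
  let α : Fin (a + 1) → Fin (c + 1) := fun i => ⟨i, by omega⟩
  let β : Fin (b + 1) → Fin (c + 1) := fun j =>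
    ⟨if (j : ℕ) < r then j else a + 1 + j - r, by split_ifs <;> omega⟩
  have hα : Function.Injective α := fun i j hij => by
    simpa [α, Fin.ext_iff] using hij
  have hβ : Function.Injective β := fun i j hij => by
    simp only [β, Fin.mk.injEq] at hij
    ext
    split_ifs at hij <;> omega
  have hsel : ∀ {n l : ℕ} (f : Fin n → Fin (c + 1)) (M : Matrix (Fin (c + 1)) (Fin l) ℂ) i m,
      ((1 : Matrix (Fin (c + 1)) (Fin (c + 1)) ℂ).submatrix f id * M) i m = M (f i) m := by
    intro n l f M i m
    simp [Matrix.mul_apply, Matrix.one_apply]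
  refine dense_of_surjective ((1 : Matrix (Fin (c + 1)) (Fin (c + 1)) ℂ).submatrix α id)
    ((1 : Matrix (Fin (c + 1)) (Fin (c + 1)) ℂ).submatrix β id) w ?_ ?_ ?_
  · convert hind.comp α hα using 1
    funext i m
    exact hsel α w i m
  · convert hind.comp β hβ using 1
    funext i m
    exact hsel β w i m
  intro u
  -- On a shared row `δw` must serve both frames, so the difference of the two targets is what
  -- remains. The default 0 is never reached, as r ≤ a + 1 and r ≤ b + 1.
  obtain ⟨x, y, z, hxyz⟩ := htan fun k m =>
    (if h : k < b + 1 ∧ m < d + 1 then u (Sum.inr (⟨k, h.1⟩, ⟨m, h.2⟩)) else 0) -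
      if h : k < a + 1 ∧ m < d + 1 then u (Sum.inl (⟨k, h.1⟩, ⟨m, h.2⟩)) else 0
  choose! μ hμ using hxyz
  -- The first a + 1 rows of `δw` are forced by V_a, and the later rows are free to solve the
  -- unshared equations of V_b; `δB` corrects the shared rows within W.
  refine ⟨Matrix.of fun k m => if h : (k : ℕ) < a + 1 then u (Sum.inl (⟨k, h⟩, m)) else
      u (Sum.inr (⟨k - (a + 1) + r, by omega⟩, m)) - (w * dRho d x y z) k m,
    Matrix.of fun j k => if (j : ℕ) < r then μ (β j) k else 0, x, y, z, fun i m => ?_, fun j m => ?_⟩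
  · rw [hsel]
    have h1 : (α i : ℕ) < a + 1 := i.2
    simp only [Matrix.of_apply, h1, dif_pos]
    rfl
  · rw [Matrix.add_apply, Matrix.add_apply, hsel, Matrix.mul_assoc, hsel, Matrix.mul_apply]
    by_cases hj : (j : ℕ) < r
    · have hβj : (β j : ℕ) = j := by simp [β, hj]
      have h1 := hμ (β j) (by omega) m
      have h2 : (β j : ℕ) < a + 1 := by omega
      have h3 : (β j : ℕ) < b + 1 := by omega
      have h4 : (⟨(β j : ℕ), h3⟩ : Fin (b + 1)) = j := Fin.ext hβj
      simp only [Matrix.of_apply, hj, if_true, h2, dif_pos, h3, h4, m.2, and_self] at h1 ⊢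
      rw [h1]
      ring
    · have hβj : (β j : ℕ) = a + 1 + j - r := by simp [β, hj]
      have h2 : ¬ (β j : ℕ) < a + 1 := by omega
      have h4 : (⟨(β j : ℕ) - (a + 1) + r, by omega⟩ : Fin (b + 1)) = j :=
        Fin.ext (by simp only [hβj]; omega)
      simp only [Matrix.of_apply, hj, if_false, h2, dif_neg, not_false_eq_true, zero_mul,
        Finset.sum_const_zero, h4]
      ring

theorem mul_row_apply {l m n : ℕ} (M : Matrix (Fin l) (Fin m) ℂ) (N : Matrix (Fin m) (Fin n) ℂ)
    (i : Fin l) (j : Fin n) : (M * N) i j = Matrix.vecMul (M i) N j := rfl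

/-- The coefficients of the monomial `s^(d-n) t^n`. -/
def stdCoeffs (d n : ℕ) (m : Fin (d + 1)) : ℂ := if (m : ℕ) = n then 1 else 0

theorem stdCoeffs_vecMul_dRho {d n : ℕ} (hn : n ≤ d) (x y z : ℂ) (m : Fin (d + 1)) :
    Matrix.vecMul (stdCoeffs d n) (dRho d x y z) m =
      (if (m : ℕ) = n then ((d : ℂ) - n) * z else 0) +
      (if (m : ℕ) = n + 1 then ((d : ℂ) - n) * y else 0) +
      (if (m : ℕ) + 1 = n then (n : ℂ) * x else 0) := by
  have h1 : stdCoeffs d n = Pi.single ⟨n, by omega⟩ 1 := by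
    funext k
    simp [stdCoeffs, Pi.single_apply, Fin.ext_iff]
  rw [h1, Matrix.single_one_vecMul]
  rfl

/-- Here r = 1. Write e_n for s^(d-n) t^n. A shared monomial would not do, since the diagonal torus
preserves its line; e_1 + e_2 is used instead, with W spanned by it and e_4, ..., e_d. The quotient
by W is detected by the coefficients of e_0 and e_3 and by the difference of those of e_1 and e_2.
-/
theorem dense_of_codim_three {a b c d : ℕ} (hc : c = a + b) (hd : d = c + 3) :
    @Dense _ (zariskiGr a b d) (Prod.snd '' incidence a b c d) := by
  let w : Matrix (Fin (c + 1)) (Fin (d + 1)) ℂ := Matrix.of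
    (Fin.cons (stdCoeffs d 1 + stdCoeffs d 2) fun k : Fin c => stdCoeffs d (k + 4))
  have hw0 : w 0 = stdCoeffs d 1 + stdCoeffs d 2 := rfl
  have hws : ∀ k : Fin c, w k.succ = stdCoeffs d (k + 4) := fun k => rfl
  refine dense_of_tangent (r := 1) (by omega) (by omega) (by omega) w
    (fun k => ⟨if (k : ℕ) = 0 then 1 else k + 3, by split_ifs <;> omega⟩) ?_ fun δ => ?_
  · intro i k
    induction i using Fin.cases with
    | zero =>
      simp only [hw0, Pi.add_apply, stdCoeffs, Fin.ext_iff, Fin.val_zero]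
      rcases k with ⟨_ | k, hk⟩ <;> simp
    | succ i =>
      simp only [hws, stdCoeffs, Fin.ext_iff, Fin.val_succ]
      rcases k with ⟨_ | k, hk⟩
      · simp
      · simp [eq_comm]
  · have hne : (c : ℂ) + 1 ≠ 0 := by exact_mod_cast Nat.succ_ne_zero c
    -- The coefficients of e_0 and e_3 determine x and y; the difference at e_1 and e_2 then gives z
    -- with coefficient (d - 1) - (d - 2) = 1.
    obtain ⟨y, hy⟩ : ∃ y, ((c : ℂ) + 1) * y = δ 0 3 := ⟨_, mul_div_cancel₀ _ hne⟩
    obtain ⟨z, hz⟩ : ∃ z, z = δ 0 1 - δ 0 2 - 2 * δ 0 0 + (c + 2) * y := ⟨_, rfl⟩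
    refine ⟨δ 0 0, y, z, fun j hj => ?_⟩
    obtain rfl : j = 0 := Fin.ext (by simpa using hj)
    refine ⟨Fin.cons (δ 0 1 - (c + 2) * z - 2 * δ 0 0) fun k : Fin c => δ 0 (k + 4), ?_⟩
    rintro ⟨m, hm⟩
    rw [Fin.sum_univ_succ]
    simp only [mul_row_apply, hw0, hws, Matrix.add_vecMul, Fin.cons_zero, Fin.cons_succ,
      Pi.add_apply, stdCoeffs_vecMul_dRho (show 1 ≤ d by omega),
      stdCoeffs_vecMul_dRho (show 2 ≤ d by omega), Fin.val_zero]
    simp only [stdCoeffs, hd]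
    push_cast
    rcases m with _ | _ | _ | _ | m
    · simp
    · simp; ring
    · simp; linear_combination -hz
    · simp; linear_combination hy
    · simp only [Nat.add_right_cancel_iff]
      rw [Finset.sum_eq_single ⟨m, by omega⟩]
      · simp
      · intro k _ hk
        rw [if_neg, mul_zero]
        rintro rfl
        exact hk rfl
      · simp

/-- Here r = 3 and W is the hyperplane where the coefficients of e_1 and e_2 sum to 0. The shared
vectors are e_0, e_1 - e_2 and e_3, on which this functional of the infinitesimal action gives a
triangular system in x, y, z. -/
theorem dense_of_codim_one {a b c d : ℕ} (hc : a + b = c + 2) (hd : d = c + 1) (ha : a ≤ c)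
    (hb : b ≤ c) : @Dense _ (zariskiGr a b d) (Prod.snd '' incidence a b c d) := by
  obtain ⟨n, rfl⟩ : ∃ n, c = n + 2 := ⟨c - 2, by omega⟩
  let w : Matrix (Fin (n + 2 + 1)) (Fin (d + 1)) ℂ := Matrix.of
    (Fin.cons (stdCoeffs d 0) (Fin.cons (stdCoeffs d 1 - stdCoeffs d 2)
      fun k : Fin (n + 1) => stdCoeffs d (k + 3)))
  have hw0 : w 0 = stdCoeffs d 0 := rfl
  have hw1 : w (Fin.succ 0) = stdCoeffs d 1 - stdCoeffs d 2 := rfl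
  have hws : ∀ k : Fin (n + 1), w k.succ.succ = stdCoeffs d (k + 3) := fun k => rfl
  refine dense_of_tangent (r := 3) (by omega) (by omega) (by omega) w
    (fun k => ⟨if (k : ℕ) ≤ 1 then k else k + 1, by split_ifs <;> omega⟩) ?_ fun δ => ?_
  · intro i k
    induction i using Fin.cases with
    | zero =>
      simp only [hw0, stdCoeffs, Fin.ext_iff, Fin.val_zero]
      rcases k with ⟨_ | _ | k, hk⟩ <;> simp
    | succ i =>
      induction i using Fin.cases with
      | zero =>
        simp only [hw1, Pi.sub_apply, stdCoeffs, Fin.ext_iff, Fin.val_zero, Fin.val_succ]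
        rcases k with ⟨_ | _ | k, hk⟩ <;> simp
      | succ i =>
        simp only [hws, stdCoeffs, Fin.ext_iff, Fin.val_succ]
        rcases k with ⟨_ | _ | k, hk⟩
        · simp
        · simp
        · simp [eq_comm]
  · have hspan : ∀ v : Fin (d + 1) → ℂ, v ⟨1, by omega⟩ + v ⟨2, by omega⟩ = 0 →
        ∃ μ : Fin (n + 2 + 1) → ℂ, ∀ m, ∑ k, μ k * w k m = v m := by
      intro v hv
      refine ⟨Fin.cons (v ⟨0, by omega⟩) (Fin.cons (v ⟨1, by omega⟩)
        fun k : Fin (n + 1) => v ⟨k + 3, by omega⟩), ?_⟩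
      rintro ⟨m, hm⟩
      rw [Fin.sum_univ_succ, Fin.sum_univ_succ]
      simp only [hw0, hw1, hws, Fin.cons_zero, Fin.cons_succ, Pi.sub_apply, stdCoeffs]
      rcases m with _ | _ | _ | m
      · simp
      · simp
      · simp; linear_combination -hv
      · simp only [Nat.add_right_cancel_iff]
        rw [Finset.sum_eq_single ⟨m, by omega⟩]
        · simp
        · intro k _ hk
          rw [if_neg, mul_zero]
          rintro rfl
          exact hk rfl
        · simp
    have hne : (n : ℂ) + 3 ≠ 0 := by exact_mod_cast Nat.succ_ne_zero (n + 2)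
    -- The row e_0 yields d·y and the row e_3 yields 3x; the row e_1 - e_2 yields z - 2x + (d - 1)y,
    -- which then determines z.
    obtain ⟨y, hy⟩ : ∃ y, ((n : ℂ) + 3) * y = δ 0 1 + δ 0 2 := ⟨_, mul_div_cancel₀ _ hne⟩
    obtain ⟨x, hx⟩ : ∃ x, 3 * x = δ 2 1 + δ 2 2 := ⟨_, mul_div_cancel₀ _ three_ne_zero⟩
    refine ⟨x, y, δ 1 1 + δ 1 2 + 2 * x - (n + 2) * y, fun j hj => hspan _ ?_⟩
    have hj' : j = 0 ∨ j = Fin.succ 0 ∨ j = Fin.succ (Fin.succ 0) := by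
      simp only [Fin.ext_iff, Fin.val_zero, Fin.val_succ]; omega
    rcases hj' with rfl | rfl | rfl
    · simp only [mul_row_apply, hw0, stdCoeffs_vecMul_dRho (Nat.zero_le d), hd]
      push_cast
      simp
      linear_combination -hy
    · simp only [mul_row_apply, hw1, Matrix.sub_vecMul, Pi.sub_apply,
        stdCoeffs_vecMul_dRho (show 1 ≤ d by omega), stdCoeffs_vecMul_dRho (show 2 ≤ d by omega), hd]
      push_cast
      simp
      ring
    · have hval : ((Fin.succ (Fin.succ 0) : Fin (n + 2 + 1)) : ℕ) = 2 := rfl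
      simp only [hval, mul_row_apply, hws, stdCoeffs_vecMul_dRho (show (0 : ℕ) + 3 ≤ d by omega),
        Fin.val_zero, hd]
      push_cast
      simp
      linear_combination -hx

theorem dense_incidence {a b c d : ℕ} (hc : c ≤ d)
    (h : ((a : ℤ) + b - c + 1) * ((d : ℤ) - c) = 3) (hac : a ≤ c) (hbc : b ≤ c) :
    @Dense _ (zariskiGr a b d) (Prod.snd '' incidence a b c d) := by
  obtain ⟨k, rfl⟩ : ∃ k, d = c + k := ⟨d - c, by omega⟩
  -- The codimension d - c divides the prime 3, which leaves only the two cases above.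
  have hk : (k : ℤ) ∣ 3 := ⟨(a : ℤ) + b - c + 1, by rw [← h]; push_cast; ring⟩
  have hk' : k ∣ 3 := by exact_mod_cast hk
  rcases (Nat.dvd_prime Nat.prime_three).1 hk' with rfl | rfl
  · exact dense_of_codim_one (by push_cast at h; omega) rfl hac hbc
  · exact dense_of_codim_three (by push_cast at h; omega) rfl

end BinaryForms

end

theorem mainTheorem3 (a b c d : ℕ) (ha : a ≤ d) (hb : b ≤ d) (hc : c ≤ d)
    (h : ((a : ℤ) + b - c + 1) * ((d : ℤ) - c) = 3) :
    (∃ U : Set (BinaryForms.Gr a d × BinaryForms.Gr b d),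
      @IsOpen _ (BinaryForms.zariskiGr a b d) U ∧ U.Nonempty ∧
      @Dense _ (BinaryForms.zariskiGr a b d) U ∧
      ∀ V ∈ U, {σ : Matrix.ProjGenLinGroup (Fin 2) ℂ |
        Module.finrank ℂ ↥(V.1.1 ⊔ BinaryForms.translate V.2.1 σ) ≤ c + 1}.Finite) ∧
    (a ≤ c → b ≤ c →
      @Dense _ (BinaryForms.zariskiGr a b d) (Prod.snd '' BinaryForms.incidence a b c d)) := by
  exact ⟨BinaryForms.exists_open_finite ha hb hc h, BinaryForms.dense_incidence hc h⟩
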